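/- Let $X$ be a real Banach space with an order cone $P$, i.e. a closed set $P\subset X$ with $P\neq\{0\}$, $0\in P$, $tP\subset P$ for all $t\ge 0$, $P+P\subset P$ and $P\cap(-P)=\{0\}$; write $x\preceq y$ if $y-x\in P$, and assume that $\operatorname{int}(P)\neq\varnothing$. Let $\{S_t\}_{t\ge0}$ be a strongly continuous semigroup of (possibly nonlinear) operators on $X$, that is, $S_0=\mathrm{id}$, $S_{s+t}=S_sS_t$, and $t\mapsto S_tx$ is continuous on $[0,\infty)$ for every $x\in X$. Assume that each $S_t$ is superadditive, $S_t(x+y)\succeq S_tx+S_ty$ for all $x,y\in X$, and positively 1-homogeneous, $S_t(cx)=cS_tx$ for all $c>0$ and $x\in X$, and that for every $t>0$ the operator $S_t$ is strongly positive, $S_t(P\setminus\{0\})\subset\operatorname{int}(P)$, and completely continuous, i.e. continuous and mapping bounded sets to relatively compact sets. Then there is a unique pair $(\rho,\hat x)\in\mathbb{R}\times\operatorname{int}(P)$ with $\|\hat x\|=1$ and $S_t\hat x=e^{\rho t}\hat x$ for all $t\ge0$, and for this pair the following hold. (i) The set $\{e^{-\rho t}S_tx : x\in P,\ \|x\|\le1,\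 t\ge1\}$ is relatively compact in $X$. (ii) For every $x\in P$ there is $\alpha^*(x)\in[0,\infty)$ such that $\lim_{t\to\infty}\|e^{-\rho t}S_tx-\alpha^*(x)\hat x\|=0$. (iii) Suppose in addition that (P1) for every $M>0$ there exist $\tau\in(0,1)$ and $\zeta_0>0$ such that $\|S_\tau(\hat x-z)\|+\|S_\tau z\|\ge\zeta_0$ for all $z\in P$ with $z\preceq\hat x$ and $\|z\|\le M$; and (P2) for every compact set $K\subset P$ there is a constant $\zeta_1$ such that $x\in K$, $\alpha\in\mathbb{R}$ and $x\preceq\alpha\hat x$ imply $\|x\|\le\alpha\zeta_1$. Then there exist $M_0>0$ and $\theta_0>0$ such that $$\|e^{-\rho t}S_tx-\alpha^*(x)\hat x\|\le M_0e^{-\theta_0t}\|x\|\qquad\text{for all }t\ge0\text{ and all }x\in P.$$ -/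

import Mathlib

open Set Filter Topology Bornology
open scoped NNReal

section OrderCone

variable {X : Type*} [NormedAddCommGroup X] [NormedSpace ℝ X]

/-- An order cone: a nontrivial (containing a nonzero vector) closed subset `P` of `X` with
`t P ⊆ P` for all `t ≥ 0`, `P + P ⊆ P` and `P ∩ (-P) = {0}`. -/
structure IsOrderCone (P : Set X) : Prop where
  isClosed : IsClosed P
  zero_mem : (0 : X) ∈ P
  exists_ne_zero : ∃ x ∈ P, x ≠ 0
  smul_mem : ∀ t : ℝ, 0 ≤ t → ∀ x ∈ P, t • x ∈ P
  add_mem : ∀ x ∈ P, ∀ y ∈ P, x + y ∈ P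
  eq_zero_of_neg_mem : ∀ x ∈ P, -x ∈ P → x = 0

/-- The partial order `x ⪯ y` induced by the cone `P`. -/
def ConeLE (P : Set X) (x y : X) : Prop := y - x ∈ P

/-- `T (x + y) ⪰ T x + T y` for all `x y`. -/
def IsSuperadditive (P : Set X) (T : X → X) : Prop :=
  ∀ x y : X, ConeLE P (T x + T y) (T (x + y))

/-- `T` maps the nonzero elements of `P` to the interior of `P`. -/
def IsStronglyPositive (P : Set X) (T : X → X) : Prop :=
  ∀ x ∈ P, x ≠ 0 → T x ∈ interior P

/-- `T (c x) = c T x` for all `c > 0` and all `x`. -/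
def IsPosHomogeneous (T : X → X) : Prop :=
  ∀ c : ℝ, 0 < c → ∀ x : X, T (c • x) = c • T x

/-- A (possibly nonlinear) map that is continuous and compact, i.e. it maps bounded sets to
relatively compact sets. -/
def IsCompletelyContinuous (T : X → X) : Prop :=
  Continuous T ∧ ∀ B : Set X, IsBounded B → IsCompact (closure (T '' B))

/-- A strongly continuous semigroup `(S t)`, `t ≥ 0`, of (possibly nonlinear) operators. -/
structure IsStronglyContinuousSemigroup (S : ℝ≥0 → X → X) : Prop where
  zero_apply : ∀ x, S 0 x = x
  add_apply : ∀ s t x, S (s + t) x = S s (S t x)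
  continuous_orbit : ∀ x, Continuous fun t => S t x

/-- A strongly continuous semigroup of superadditive, strongly positive, positively
1-homogeneous, completely continuous operators. As `S 0` is the identity, strong positivity
and complete continuity are required for `t > 0`. -/
structure IsSuperadditiveSemigroup (P : Set X) (S : ℝ≥0 → X → X) : Prop
    extends IsStronglyContinuousSemigroup S where
  superadditive : ∀ t, IsSuperadditive P (S t)
  posHomogeneous : ∀ t, IsPosHomogeneous (S t)
  stronglyPositive : ∀ t, 0 < t → IsStronglyPositive P (S t)
  completelyContinuous : ∀ t, 0 < t → IsCompletelyContinuous (S t)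

/-- `x̂ ∈ int P`, `‖x̂‖ = 1` and `S t x̂ = e^{ρ t} x̂` for all `t ≥ 0`. -/
def IsPrincipalEigenpair (P : Set X) (S : ℝ≥0 → X → X) (ρ : ℝ) (xhat : X) : Prop :=
  xhat ∈ interior P ∧ ‖xhat‖ = 1 ∧ ∀ t : ℝ≥0, S t xhat = Real.exp (ρ * t) • xhat

/-- The normalized orbit `{e^{-ρ t} S t x : x ∈ P, ‖x‖ ≤ 1, t ≥ 1}`. -/
def normalizedOrbit (P : Set X) (S : ℝ≥0 → X → X) (ρ : ℝ) : Set X :=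
  {y | ∃ x ∈ P, ‖x‖ ≤ 1 ∧ ∃ t : ℝ≥0, 1 ≤ t ∧ y = Real.exp (-(ρ * t)) • S t x}

/-- For every `M > 0` there are `τ ∈ (0, 1)` and `ζ₀ > 0` with
`‖S τ (x̂ - z)‖ + ‖S τ z‖ ≥ ζ₀` whenever `z ∈ P`, `z ⪯ x̂` and `‖z‖ ≤ M`. -/
def PropertyP1 (P : Set X) (S : ℝ≥0 → X → X) (xhat : X) : Prop :=
  ∀ M : ℝ, 0 < M → ∃ τ : ℝ≥0, 0 < τ ∧ τ < 1 ∧ ∃ ζ₀ : ℝ, 0 < ζ₀ ∧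
    ∀ z ∈ P, ConeLE P z xhat → ‖z‖ ≤ M → ζ₀ ≤ ‖S τ (xhat - z)‖ + ‖S τ z‖

/-- For every compact `K ⊆ P` there is a constant `ζ₁` such that `x ∈ K` and `x ⪯ α x̂` imply
`‖x‖ ≤ α ζ₁`. -/
def PropertyP2 (P : Set X) (xhat : X) : Prop :=
  ∀ K : Set X, IsCompact K → K ⊆ P → ∃ ζ₁ : ℝ,
    ∀ x ∈ K, ∀ α : ℝ, ConeLE P x (α • xhat) → ‖x‖ ≤ α * ζ₁

end OrderCone

/-! Superadditivity and strong positivity give a strong comparison principle: if `x ⪯ y` and `x ≠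
y`, then `T y - T x` is interior. The cone need not be normal, so order intervals may be unbounded.
What replaces normality is that `T` grows sublinearly on them: rescaled images of a counterexample
converge to a nonzero element of `P ∩ (-P)` (`exists_norm_le_add_mul_norm`).

For one operator, the eigenvalue is the infimum of the `r > 0` admitting a solution of `T x + e ⪯ r
x` in `P`. Monotone iteration turns supersolutions into solutions; normalized solutions converge,
and minimality kills the inhomogeneous term in the limit. Strong comparison gives uniqueness up to
scaling. Hence `S t` preserves the ray of the eigenvector of `S 1`, with an exponential factor.

After rescaling, `xhat` is a fixed point. Baire's theorem in time and sublinear growth bound the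
orbits, and complete continuity makes them precompact. The largest `c` with `c xhat ⪯ S t x`
increases in `t`; strong comparison forces every cluster point to be its limit times `xhat`.

Under (P2) the cone is normal. With (P1) and compactness, one of `z` and `xhat - z` gains a fixed
multiple of `xhat` by a fixed time, so order intervals around an orbit shrink geometrically. -/

section ConeLemmas

variable {X : Type*} [NormedAddCommGroup X] [NormedSpace ℝ X] {P : Set X}

/-! ### Order cones with interior points. -/

namespace IsOrderCone

lemma sub_mem_trans (hP : IsOrderCone P) {x y z : X} (h₁ : y - x ∈ P) (h₂ : z - y ∈ P) :
    z - x ∈ P := by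
  have := hP.add_mem _ h₁ _ h₂
  rwa [show y - x + (z - y) = z - x by abel] at this

lemma add_mem_interior (hP : IsOrderCone P) {x y : X} (hx : x ∈ interior P) (hy : y ∈ P) :
    x + y ∈ interior P := by
  have ho : IsOpen ((fun z => z - y) ⁻¹' interior P) :=
    isOpen_interior.preimage (by fun_prop)
  refine interior_maximal (fun z hz => ?_) ho (by simpa using hx)
  have := hP.add_mem _ (interior_subset hz) _ hy
  simpa using this

lemma smul_mem_interior (hP : IsOrderCone P) {x : X} (hx : x ∈ interior P) {c : ℝ} (hc : 0 < c) :
    c • x ∈ interior P := by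
  have ho : IsOpen ((fun z : X => c⁻¹ • z) ⁻¹' interior P) :=
    isOpen_interior.preimage (by fun_prop)
  refine interior_maximal (fun z hz => ?_) ho (by simpa [smul_smul, hc.ne'] using hx)
  have := hP.smul_mem c hc.le _ (interior_subset hz)
  simpa [smul_smul, hc.ne'] using this

/-- An interior point of the cone dominates every vector, linearly in its norm. -/
lemma exists_smul_sub_mem (hP : IsOrderCone P) {e : X} (he : e ∈ interior P) :
    ∃ m : ℝ, 0 < m ∧ ∀ x : X, ∀ b : ℝ, m * ‖x‖ ≤ b → b • e - x ∈ P := by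
  obtain ⟨ε, hε, hb⟩ := Metric.isOpen_iff.1 isOpen_interior e he
  refine ⟨2 / ε, by positivity, fun x b hxb => ?_⟩
  rcases eq_or_ne x 0 with rfl | hx
  · simpa using hP.smul_mem b (by simpa using hxb) e (interior_subset he)
  have hn : 0 < ‖x‖ := norm_pos_iff.2 hx
  have h1 : e - (ε / (2 * ‖x‖)) • x ∈ P := by
    refine interior_subset (hb ?_)
    rw [Metric.mem_ball, dist_eq_norm, sub_sub_cancel_left, norm_neg, norm_smul,
      Real.norm_of_nonneg (by positivity)]
    field_simp
    linarith
  have h2 := hP.smul_mem (2 / ε * ‖x‖) (by positivity) _ h1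
  have h3 := hP.smul_mem (b - 2 / ε * ‖x‖) (by linarith) e (interior_subset he)
  have h4 := hP.add_mem _ h2 _ h3
  have h5 : 2 / ε * ‖x‖ * (ε / (2 * ‖x‖)) = 1 := by field_simp
  rw [smul_sub, smul_smul, h5, one_smul, sub_smul] at h4
  convert h4 using 1
  abel

lemma ne_zero_of_mem_interior (hP : IsOrderCone P) {e : X} (he : e ∈ interior P) : e ≠ 0 := by
  rintro rfl
  obtain ⟨m, -, hm⟩ := hP.exists_smul_sub_mem he
  obtain ⟨x, hx, hx0⟩ := hP.exists_ne_zero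
  exact hx0 (hP.eq_zero_of_neg_mem x hx (by simpa using hm x _ le_rfl))

lemma nonneg_of_smul_mem (hP : IsOrderCone P) {e : X} (he : e ∈ P) (he0 : e ≠ 0) {c : ℝ}
    (h : c • e ∈ P) : 0 ≤ c := by
  by_contra! hc
  have h1 := hP.smul_mem (-c) (by linarith) e he
  rw [neg_smul] at h1
  have := hP.eq_zero_of_neg_mem _ h h1
  exact (smul_ne_zero hc.ne he0) this

lemma le_of_smul_sub_smul_mem (hP : IsOrderCone P) {e x : X} (he : e ∈ P) (he0 : e ≠ 0) {a b : ℝ}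
    (ha : x - a • e ∈ P) (hb : b • e - x ∈ P) : a ≤ b := by
  have := hP.sub_mem_trans ha hb
  rw [← sub_smul] at this
  linarith [hP.nonneg_of_smul_mem he he0 this]

/-- The largest `c` with `c e ⪯ x`. -/
lemma exists_isGreatest_smul (hP : IsOrderCone P) {e : X} (he : e ∈ interior P) (x : X) :
    ∃ c : ℝ, IsGreatest {c : ℝ | x - c • e ∈ P} c := by
  obtain ⟨m, -, hm⟩ := hP.exists_smul_sub_mem he
  have hc : IsClosed {c : ℝ | x - c • e ∈ P} := hP.isClosed.preimage (by fun_prop)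
  have hne : {c : ℝ | x - c • e ∈ P}.Nonempty := by
    refine ⟨-(m * ‖-x‖), ?_⟩
    have := hm (-x) _ le_rfl
    simpa [add_comm] using this
  have hbd : BddAbove {c : ℝ | x - c • e ∈ P} :=
    ⟨m * ‖x‖, fun c hc => hP.le_of_smul_sub_smul_mem (interior_subset he)
      (hP.ne_zero_of_mem_interior he) hc (hm x _ le_rfl)⟩
  exact ⟨_, hc.csSup_mem hne hbd, fun c h => le_csSup hbd h⟩

/-- A compact set of interior points lies uniformly inside the cone. -/
lemma exists_forall_sub_smul_mem (hP : IsOrderCone P) {K : Set X} (hK : IsCompact K)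
    (hKP : K ⊆ interior P) {e : X} (he : e ∈ P) :
    ∃ κ : ℝ, 0 < κ ∧ κ < 1 ∧ ∀ y ∈ K, ∀ c ≤ κ, y - c • e ∈ P := by
  obtain ⟨δ, hδ, hsub⟩ := hK.exists_thickening_subset_open isOpen_interior hKP
  have hpos : 0 < min (1 / 2) (δ / (2 * (‖e‖ + 1))) := lt_min (by norm_num) (by positivity)
  refine ⟨min (1 / 2) (δ / (2 * (‖e‖ + 1))), hpos,
    (min_le_left _ _).trans_lt (by norm_num), fun y hy c hc => ?_⟩
  set κ := min (1 / 2) (δ / (2 * (‖e‖ + 1))) with hκ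
  have h1 : y - κ • e ∈ P := by
    refine interior_subset (hsub (Metric.mem_thickening_iff.2 ⟨y, hy, ?_⟩))
    rw [dist_eq_norm, sub_sub_cancel_left, norm_neg, norm_smul, Real.norm_of_nonneg hpos.le]
    have h2 : κ ≤ δ / (2 * (‖e‖ + 1)) := min_le_right _ _
    have h3 : δ / (2 * (‖e‖ + 1)) * (‖e‖ + 1) = δ / 2 := by field_simp
    have h4 : κ * ‖e‖ ≤ δ / (2 * (‖e‖ + 1)) * (‖e‖ + 1) := by gcongr; linarith
    linarith
  have h2 := hP.add_mem _ h1 _ (hP.smul_mem (κ - c) (by linarith) e he)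
  rw [sub_smul] at h2
  convert h2 using 1
  abel

lemma exists_sub_smul_mem (hP : IsOrderCone P) {y e : X} (hy : y ∈ interior P) (he : e ∈ P) :
    ∃ κ : ℝ, 0 < κ ∧ y - κ • e ∈ P := by
  obtain ⟨κ, h0, -, h⟩ := hP.exists_forall_sub_smul_mem (isCompact_singleton (x := y))
    (by simpa using hy) he
  exact ⟨κ, h0, h y rfl κ le_rfl⟩

/-- Property (P2) forces the cone to be normal. -/
lemma exists_norm_le_of_propertyP2 (hP : IsOrderCone P) {xhat : X} (hx : xhat ∈ interior P)
    (h2 : PropertyP2 P xhat) :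
    ∃ ζ : ℝ, 0 < ζ ∧ ∀ x ∈ P, ∀ α : ℝ, α • xhat - x ∈ P → ‖x‖ ≤ α * ζ := by
  have hxP := interior_subset hx
  have hx0 := hP.ne_zero_of_mem_interior hx
  by_contra! hcon
  have hcon' := fun n : ℕ => hcon (n + 1) (by positivity)
  choose x hxm α hα hlt using hcon'
  have hα0 : ∀ n, 0 ≤ α n := fun n => by
    refine hP.nonneg_of_smul_mem hxP hx0 ?_
    simpa using hP.add_mem _ (hα n) _ (hxm n)
  have hxn : ∀ n, 0 < ‖x n‖ := fun n => (mul_nonneg (hα0 n) (by positivity)).trans_lt (hlt n)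
  let u : ℕ → X := fun n => (1 / ((n + 1) * ‖x n‖)) • x n
  have hun : ∀ n, ‖u n‖ = 1 / ((n : ℝ) + 1) := fun n => by
    have := hxn n
    simp only [u, norm_smul]
    rw [Real.norm_of_nonneg (by positivity)]
    field_simp
  have hu0 : Tendsto u atTop (𝓝 0) := by
    rw [tendsto_zero_iff_norm_tendsto_zero]
    simp_rw [hun]
    exact tendsto_one_div_add_atTop_nhds_zero_nat
  obtain ⟨ζ, hζ⟩ := h2 (insert 0 (range u)) hu0.isCompact_insert_range (by
    rintro y (rfl | ⟨n, rfl⟩)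
    · exact hP.zero_mem
    · exact hP.smul_mem _ (by positivity) _ (hxm n))
  obtain ⟨n, hn⟩ := exists_nat_gt ζ
  have h3 := hζ (u n) (mem_insert_of_mem _ ⟨n, rfl⟩) ((1 / ((n + 1) * ‖x n‖)) * α n) (by
    have := hP.smul_mem (1 / ((n + 1) * ‖x n‖)) (by positivity) _ (hα n)
    rwa [smul_sub, smul_smul] at this)
  rw [hun] at h3
  have h4 := hxn n
  have h5 : ‖x n‖ ≤ α n * ζ := by
    field_simp at h3
    exact h3
  have h6 : α n * ζ ≤ α n * (n + 1) := mul_le_mul_of_nonneg_left (by linarith) (hα0 n)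
  linarith [hlt n]

end IsOrderCone

end ConeLemmas

/-! ### A single superadditive compact map: a Krein–Rutman theorem. -/

section ConeMaps

variable {X : Type*} [NormedAddCommGroup X] {T : X → X}

lemma IsCompletelyContinuous.exists_subseq_tendsto (hT : IsCompletelyContinuous T) {x : ℕ → X}
    {C : ℝ} (hx : ∀ n, ‖x n‖ ≤ C) :
    ∃ v, ∃ φ : ℕ → ℕ, StrictMono φ ∧ Tendsto (fun n => T (x (φ n))) atTop (𝓝 v) := by
  have hc := hT.2 (Metric.closedBall 0 C) Metric.isBounded_closedBall
  obtain ⟨v, -, φ, hφ, h⟩ := hc.tendsto_subseq (x := fun n => T (x n)) (fun n =>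
    subset_closure ⟨x n, by simpa using hx n, rfl⟩)
  exact ⟨v, φ, hφ, h⟩

variable [NormedSpace ℝ X] {P : Set X}

lemma IsPosHomogeneous.map_zero (hT : IsPosHomogeneous T) : T 0 = 0 := by
  have h := hT 2 two_pos 0
  rw [smul_zero, two_smul] at h
  exact left_eq_add.1 h

lemma IsPosHomogeneous.map_smul (hT : IsPosHomogeneous T) {c : ℝ} (hc : 0 ≤ c) (x : X) :
    T (c • x) = c • T x := by
  rcases hc.eq_or_lt with rfl | hc
  · simp [hT.map_zero]
  · exact hT c hc x

lemma IsCompletelyContinuous.exists_norm_le (hT : IsCompletelyContinuous T)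
    (hh : IsPosHomogeneous T) : ∃ C : ℝ, 0 < C ∧ ∀ x, ‖T x‖ ≤ C * ‖x‖ := by
  have hc := hT.2 (Metric.closedBall 0 1) Metric.isBounded_closedBall
  obtain ⟨C, hC0, hC⟩ := hc.isBounded.exists_pos_norm_le
  refine ⟨C, hC0, fun x => ?_⟩
  have h1 : T (‖x‖ • (‖x‖⁻¹ • x)) = ‖x‖ • T (‖x‖⁻¹ • x) := hh.map_smul (norm_nonneg x) _
  rcases eq_or_ne x 0 with rfl | hx
  · simp [hh.map_zero]
  have hn : ‖x‖ ≠ 0 := norm_ne_zero_iff.2 hx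
  rw [smul_smul, mul_inv_cancel₀ hn, one_smul] at h1
  rw [h1, norm_smul, norm_norm, mul_comm]
  refine mul_le_mul_of_nonneg_right (hC _ (subset_closure ⟨_, ?_, rfl⟩)) (norm_nonneg x)
  simp [norm_smul, hn]

/-- Writing `y = x + (y - x)`, superadditivity gives `T y ⪰ T x + T (y - x)`, and the last term is
in the cone. Strong positivity makes it interior when `y ≠ x`, whence `strict_mono`. -/
lemma IsSuperadditive.mono (hP : IsOrderCone P) (hs : IsSuperadditive P T)
    (hp : ∀ x ∈ P, T x ∈ P) {x y : X} (h : y - x ∈ P) : T y - T x ∈ P := by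
  have h1 := hs x (y - x)
  rw [ConeLE, add_sub_cancel] at h1
  have h2 := hP.add_mem _ h1 _ (hp _ h)
  convert h2 using 1
  abel

lemma IsSuperadditive.strict_mono (hP : IsOrderCone P) (hs : IsSuperadditive P T)
    (hp : IsStronglyPositive P T) {x y : X} (h : y - x ∈ P) (hne : y ≠ x) :
    T y - T x ∈ interior P := by
  have h1 := hs x (y - x)
  rw [ConeLE, add_sub_cancel] at h1
  have h2 := hP.add_mem_interior (hp _ h (sub_ne_zero.2 hne)) h1
  convert h2 using 1
  abel

/-- The hypotheses on the operators `S t`, `t > 0`, for a single operator. -/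
structure IsCompactConeMap (P : Set X) (T : X → X) : Prop where
  superadditive : IsSuperadditive P T
  posHomogeneous : IsPosHomogeneous T
  stronglyPositive : IsStronglyPositive P T
  completelyContinuous : IsCompletelyContinuous T

namespace IsCompactConeMap

lemma mapsTo (hP : IsOrderCone P) (hT : IsCompactConeMap P T) {x : X} (hx : x ∈ P) :
    T x ∈ P := by
  rcases eq_or_ne x 0 with rfl | h0
  · rw [hT.posHomogeneous.map_zero]; exact hP.zero_mem
  · exact interior_subset (hT.stronglyPositive x hx h0)

lemma mono (hP : IsOrderCone P) (hT : IsCompactConeMap P T) {x y : X} (h : y - x ∈ P) :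
    T y - T x ∈ P :=
  hT.superadditive.mono hP (fun _ => hT.mapsTo hP) h

/-- On an order interval `[0, m e]`, which need not be bounded, `T` grows sublinearly. -/
lemma exists_norm_le_add_mul_norm (hP : IsOrderCone P) (hT : IsCompactConeMap P T) (e : X)
    {m : ℝ} (hm : 0 ≤ m) {ε : ℝ} (hε : 0 < ε) :
    ∃ C : ℝ, 0 ≤ C ∧ ∀ y ∈ P, m • e - y ∈ P → ‖T y‖ ≤ C + ε * ‖y‖ := by
  obtain ⟨B, hB0, hB⟩ := hT.completelyContinuous.exists_norm_le hT.posHomogeneous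
  by_contra! hcon
  have hcon' := fun n : ℕ => hcon (n + 1) (by positivity)
  choose y hyP hye hlt using hcon'
  have hyB : ∀ n : ℕ, (n : ℝ) + 1 ≤ B * ‖y n‖ := fun n => by
    have h1 := hlt n
    have h2 := hB (y n)
    have h3 : 0 ≤ ε * ‖y n‖ := by positivity
    linarith
  have hy0 : ∀ n, 0 < ‖y n‖ := fun n => by
    have h := hyB n
    have h2 : 0 < B * ‖y n‖ := lt_of_lt_of_le (by positivity : (0 : ℝ) < n + 1) h
    exact pos_of_mul_pos_right h2 hB0.le
  let u : ℕ → X := fun n => ‖y n‖⁻¹ • y n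
  have hun : ∀ n, ‖u n‖ ≤ 1 := fun n => by
    simp [u, norm_smul, (hy0 n).ne']
  have hTu : ∀ n, T (u n) = ‖y n‖⁻¹ • T (y n) := fun n =>
    hT.posHomogeneous.map_smul (by positivity) _
  have hTun : ∀ n, ε ≤ ‖T (u n)‖ := fun n => by
    have h := hy0 n
    rw [hTu, norm_smul, norm_inv, norm_norm, ← div_eq_inv_mul, le_div_iff₀ h]
    have : (0 : ℝ) ≤ n + 1 := by positivity
    linarith [hlt n]
  have hle : ∀ n, (m * ‖y n‖⁻¹) • T e - T (u n) ∈ P := fun n => by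
    have h1 := hT.mono hP (hye n)
    rw [hT.posHomogeneous.map_smul hm] at h1
    have h2 := hP.smul_mem ‖y n‖⁻¹ (by positivity) _ h1
    rwa [smul_sub, smul_smul, ← hTu, mul_comm] at h2
  obtain ⟨v, φ, hφ, hv⟩ := hT.completelyContinuous.exists_subseq_tendsto hun
  have hinv : Tendsto (fun n => ‖y n‖⁻¹) atTop (𝓝 0) := by
    have h1 : Tendsto (fun n : ℕ => B * (1 / ((n : ℝ) + 1))) atTop (𝓝 0) := by
      simpa using tendsto_one_div_add_atTop_nhds_zero_nat.const_mul B
    refine squeeze_zero (fun n => by positivity) (fun n => ?_) h1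
    have h2 := hyB n
    have h3 := hy0 n
    field_simp
    linarith
  have hvP : v ∈ P := hP.isClosed.mem_of_tendsto hv (Eventually.of_forall fun n =>
    hT.mapsTo hP (hP.smul_mem _ (by positivity) _ (hyP _)))
  -- The upper bounds `(m / ‖y n‖) T e` of `T (u n)` tend to `0`, since `‖y n‖ → ∞`.
  have hvn : -v ∈ P := by
    have h1 : Tendsto (fun n => (m * ‖y (φ n)‖⁻¹) • T e - T (u (φ n))) atTop (𝓝 (-v)) := by
      have := (((hinv.comp hφ.tendsto_atTop).const_mul m).smul_const (T e)).sub hv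
      simpa using this
    exact hP.isClosed.mem_of_tendsto h1 (Eventually.of_forall fun n => hle _)
  have hv0 := hP.eq_zero_of_neg_mem v hvP hvn
  have h1 : ε ≤ ‖v‖ := ge_of_tendsto hv.norm (Eventually.of_forall fun n => hTun _)
  rw [hv0, norm_zero] at h1
  linarith

/-- Monotone iteration from `0` below a supersolution of `T x + e = r x`. -/
lemma exists_map_add_eq (hP : IsOrderCone P) (hT : IsCompactConeMap P T) {e : X}
    (he : e ∈ interior P) {r : ℝ} (hr : 0 < r) {z : X} (hz : z ∈ P) (h : r • z - T z - e ∈ P) :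
    ∃ y ∈ P, T y + e = r • y := by
  have heP := interior_subset he
  let x : ℕ → X := fun n => (fun w => r⁻¹ • (T w + e))^[n] 0
  have hx0 : x 0 = 0 := rfl
  have hxs : ∀ n, x (n + 1) = r⁻¹ • (T (x n) + e) := fun n => by
    simp only [x, Function.iterate_succ_apply']
  have hr' : 0 ≤ r⁻¹ := by positivity
  have hxP : ∀ n, x n ∈ P := fun n => by
    induction n with
    | zero => exact hP.zero_mem
    | succ n ih =>
      rw [hxs]
      exact hP.smul_mem _ hr' _ (hP.add_mem _ (hT.mapsTo hP ih) _ heP)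
  have hstep : ∀ n, x (n + 1) - x n ∈ P := fun n => by
    induction n with
    | zero => rw [hx0, sub_zero]; exact hxP 1
    | succ n ih =>
      rw [hxs (n + 1)]
      nth_rewrite 2 [hxs n]
      have := hP.smul_mem _ hr' _ (hT.mono hP ih)
      rw [← smul_sub, add_sub_add_right_eq_sub]
      exact this
  have hmono : ∀ n k, x (n + k) - x n ∈ P := fun n k => by
    induction k with
    | zero => simpa using hP.zero_mem
    | succ k ih => exact hP.sub_mem_trans ih (hstep _)
  have hxz : ∀ n, z - x n ∈ P := fun n => by
    induction n with
    | zero => simpa [hx0] using hz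
    | succ n ih =>
      have h1 := hP.smul_mem _ hr' _ (hP.add_mem _ h _ (hT.mono hP ih))
      rw [hxs]
      convert h1 using 1
      rw [show r • z - T z - e + (T z - T (x n)) = r • z - (T (x n) + e) by abel, smul_sub,
        smul_smul, inv_mul_cancel₀ hr.ne', one_smul]
  obtain ⟨m, hm0, hm⟩ := hP.exists_smul_sub_mem he
  -- Slope `r / 2` against the factor `r⁻¹` of the iteration halves the previous norm, so the
  -- iterates stay bounded.
  obtain ⟨C, hC0, hC⟩ := hT.exists_norm_le_add_mul_norm hP e (m := m * ‖z‖) (by positivity)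
    (ε := r / 2) (by positivity)
  have hbd : ∀ n, ‖x n‖ ≤ 2 * r⁻¹ * (C + ‖e‖) := fun n => by
    induction n with
    | zero => rw [hx0, norm_zero]; positivity
    | succ n ih =>
      have h1 := hC (x n) (hxP n) (hP.sub_mem_trans (hxz n) (hm z _ le_rfl))
      rw [hxs, norm_smul, Real.norm_of_nonneg hr']
      calc r⁻¹ * ‖T (x n) + e‖ ≤ r⁻¹ * (C + r / 2 * (2 * r⁻¹ * (C + ‖e‖)) + ‖e‖) := by
            gcongr
            refine (norm_add_le _ _).trans ?_
            gcongr
            refine h1.trans ?_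
            gcongr
        _ = _ := by field_simp; ring
  obtain ⟨v, φ, hφ, hv⟩ := hT.completelyContinuous.exists_subseq_tendsto hbd
  have hy1 : Tendsto (fun n => x (φ n + 1)) atTop (𝓝 (r⁻¹ • (v + e))) := by
    simp_rw [hxs]
    exact (hv.add_const e).const_smul _
  obtain ⟨y, hy⟩ : ∃ y, y = r⁻¹ • (v + e) := ⟨_, rfl⟩
  rw [← hy] at hy1
  have hxy : ∀ n, y - x n ∈ P := fun n => by
    refine hP.isClosed.mem_of_tendsto (hy1.sub_const (x n)) ?_
    filter_upwards [eventually_ge_atTop n] with k hk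
    have h1 : n ≤ φ k + 1 := hk.trans ((hφ.id_le k).trans (Nat.le_succ _))
    obtain ⟨j, hj⟩ := Nat.exists_eq_add_of_le h1
    rw [hj]
    exact hmono n j
  have hyP : y ∈ P := by simpa [hx0] using hxy 0
  refine ⟨y, hyP, ?_⟩
  have h2 : Tendsto (fun n => x (φ n + 1 + 1)) atTop (𝓝 (r⁻¹ • (T y + e))) := by
    simp_rw [hxs (φ _ + 1)]
    exact (((hT.completelyContinuous.1.tendsto y).comp hy1).add_const e).const_smul _
  -- Only a subsequence converges, so `y` is not yet a fixed point. Passing to the limit in `x k ⪯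
  -- y` and in `x k ⪯ x (k + 1)` gives the two opposite inequalities.
  have h3 : y - r⁻¹ • (T y + e) ∈ P :=
    hP.isClosed.mem_of_tendsto (h2.const_sub y) (Eventually.of_forall fun n => hxy _)
  have h4 : r⁻¹ • (T y + e) - y ∈ P :=
    hP.isClosed.mem_of_tendsto (h2.sub hy1) (Eventually.of_forall fun n => hstep _)
  have h5 := hP.eq_zero_of_neg_mem _ h3 (by simpa using h4)
  rw [sub_eq_zero] at h5
  nth_rewrite 2 [h5]
  rw [smul_smul, mul_inv_cancel₀ hr.ne', one_smul]

/-- Krein–Rutman: existence of a positive eigenvector. -/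
lemma exists_eigenvector (hP : IsOrderCone P) (hPint : (interior P).Nonempty)
    (hT : IsCompactConeMap P T) :
    ∃ r : ℝ, 0 < r ∧ ∃ x ∈ interior P, ‖x‖ = 1 ∧ T x = r • x := by
  obtain ⟨e, he⟩ := hPint
  have heP := interior_subset he
  have he0 := hP.ne_zero_of_mem_interior he
  obtain ⟨m, hm0, hm⟩ := hP.exists_smul_sub_mem he
  obtain ⟨δ, hδ0, hδ⟩ := hP.exists_sub_smul_mem (hT.stronglyPositive e heP he0) heP
  let Λ : Set ℝ := {r | 0 < r ∧ ∃ x ∈ P, r • x - T x - e ∈ P}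
  have hne : Λ.Nonempty := by
    refine ⟨m * ‖T e‖ + 1, by positivity, e, heP, ?_⟩
    have := hm (T e) _ le_rfl
    rw [add_smul, one_smul]
    convert this using 1
    abel
  -- With `c` the largest number such that `c e ⪯ x`, one has `r x ⪰ T x + e ⪰ (1 + c δ) e`, so
  -- maximality yields `1 + c δ ≤ r c`.
  have hΛδ : ∀ r ∈ Λ, δ ≤ r := by
    rintro r ⟨hr, x, hx, h⟩
    obtain ⟨c, hc, hmax⟩ := hP.exists_isGreatest_smul he x
    have hc0 : 0 ≤ c := hmax (by simpa using hx)
    have h1 := hT.mono hP hc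
    rw [hT.posHomogeneous.map_smul hc0] at h1
    have h2 := hP.add_mem _ (hP.add_mem _ h _ h1) _ (hP.smul_mem c hc0 _ hδ)
    have h3 : x - (r⁻¹ * (1 + c * δ)) • e ∈ P := by
      have h4 := hP.smul_mem r⁻¹ (by positivity) _ h2
      convert h4 using 1
      have h5 : x = r⁻¹ • (r • x) := by rw [smul_smul, inv_mul_cancel₀ hr.ne', one_smul]
      nth_rewrite 1 [h5]
      module
    have h4 : r⁻¹ * (1 + c * δ) ≤ c := hmax h3
    rw [inv_mul_le_iff₀ hr] at h4
    by_contra! h5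
    nlinarith
  have hbdd : BddBelow Λ := ⟨δ, fun r hr => hΛδ r hr⟩
  set r := sInf Λ with hr_def
  have hr0 : 0 < r := hδ0.trans_le (le_csInf hne hΛδ)
  obtain ⟨l, -, hl, hlΛ⟩ := exists_seq_tendsto_sInf hne hbdd
  have hsol : ∀ n, ∃ y ∈ P, T y + e = l n • y := fun n => by
    obtain ⟨h0, z, hz, h⟩ := hlΛ n
    exact hT.exists_map_add_eq hP he h0 hz h
  choose x hxP hx using hsol
  -- This normalization needs no bound on `x n`: vector and inhomogeneity `s n • e` both stay
  -- bounded, and `‖s n • x n‖ + s n = 1` keeps them from vanishing together.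
  let s : ℕ → ℝ := fun n => (1 + ‖x n‖)⁻¹
  have hs0 : ∀ n, 0 < s n := fun n => by simp only [s]; positivity
  have hs1 : ∀ n, s n ≤ 1 := fun n => by
    simp only [s]; exact inv_le_one_of_one_le₀ (by linarith [norm_nonneg (x n)])
  have hwn : ∀ n, ‖s n • x n‖ = 1 - s n := fun n => by
    rw [norm_smul, Real.norm_of_nonneg (hs0 n).le]
    simp only [s]
    field_simp
    ring
  have hw : ∀ n, s n • x n = (l n)⁻¹ • (T (s n • x n) + s n • e) := fun n => by
    rw [hT.posHomogeneous.map_smul (hs0 n).le, ← smul_add, hx, smul_comm (s n), smul_smul,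
      inv_mul_cancel₀ (hlΛ n).1.ne', one_smul]
  obtain ⟨v, φ, hφ, hv⟩ := hT.completelyContinuous.exists_subseq_tendsto
    (x := fun n => s n • x n) (C := 1) (fun n => by rw [hwn]; linarith [hs0 n])
  obtain ⟨ε, hε, ψ, hψ, hsε⟩ := isCompact_Icc.tendsto_subseq (x := fun n => s (φ n))
    (fun n => (⟨(hs0 _).le, hs1 _⟩ : s (φ n) ∈ Icc (0 : ℝ) 1))
  have hv' := hv.comp hψ.tendsto_atTop
  have hl' := hl.comp (hφ.comp hψ).tendsto_atTop
  have hwlim : Tendsto (fun n => s (φ (ψ n)) • x (φ (ψ n))) atTop (𝓝 (r⁻¹ • (v + ε • e))) := by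
    have h1 := (hl'.inv₀ hr0.ne').smul (hv'.add (hsε.smul_const e))
    refine h1.congr fun n => ?_
    exact (hw _).symm
  obtain ⟨w, hw'⟩ : ∃ w, w = r⁻¹ • (v + ε • e) := ⟨_, rfl⟩
  rw [← hw'] at hwlim
  have hTw : T w = v :=
    tendsto_nhds_unique ((hT.completelyContinuous.1.tendsto w).comp hwlim) hv'
  have hwP : w ∈ P := hP.isClosed.mem_of_tendsto hwlim
    (Eventually.of_forall fun n => hP.smul_mem _ (hs0 _).le _ (hxP _))
  have hwnorm : ‖w‖ = 1 - ε := by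
    refine tendsto_nhds_unique hwlim.norm ?_
    simp_rw [hwn]
    exact hsε.const_sub 1
  have hweq : T w + ε • e = r • w := by
    rw [hTw, hw', smul_smul, mul_inv_cancel₀ hr0.ne', one_smul]
  rcases hε.1.eq_or_lt with h0 | h0
  · rw [← h0] at hweq hwnorm
    have hw0 : w ≠ 0 := by
      rintro rfl
      simp at hwnorm
    refine ⟨r, hr0, w, ?_, by simpa using hwnorm, by simpa using hweq⟩
    have h1 := hP.smul_mem_interior (hT.stronglyPositive w hwP hw0) (inv_pos.2 hr0)
    rw [show T w = r • w by simpa using hweq, smul_smul, inv_mul_cancel₀ hr0.ne', one_smul] at h1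
    exact h1
  · exfalso
    -- `(r - η) (2 ε⁻¹ w)` is still a supersolution for small `η`
    set η : ℝ := min (r / 2) (ε / (2 * (m * ‖w‖ + 1))) with hη
    have hη0 : 0 < η := lt_min (by positivity) (by positivity)
    have hη1 : η ≤ r / 2 := min_le_left _ _
    have hη2 : η * (m * ‖w‖ + 1) ≤ ε / 2 := by
      have : η ≤ ε / (2 * (m * ‖w‖ + 1)) := min_le_right _ _
      rw [le_div_iff₀ (by positivity)] at this
      linarith
    -- The vector `z = 2 ε⁻¹ w` satisfies `T z + 2 e = r z`; the spare `e` absorbs `η z`.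
    have hmem : r - η ∈ Λ := by
      refine ⟨by linarith, (2 * ε⁻¹) • w, hP.smul_mem _ (by positivity) _ hwP, ?_⟩
      have h1 := hm w (ε / (2 * η)) (by rw [le_div_iff₀ (by positivity)]; nlinarith)
      have h2 := hP.smul_mem (2 * ε⁻¹ * η) (by positivity) _ h1
      convert h2 using 1
      rw [hT.posHomogeneous.map_smul (by positivity), eq_sub_of_add_eq hweq, smul_sub, smul_sub,
        smul_smul, smul_smul, smul_smul, smul_smul,
        show 2 * ε⁻¹ * η * (ε / (2 * η)) = 1 by field_simp,
        show 2 * ε⁻¹ * ε = 2 by field_simp]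
      module
    have := csInf_le hbdd hmem
    linarith

/-- Positive eigenvectors are unique up to scaling. -/
lemma eigenvector_unique (hP : IsOrderCone P) (hT : IsCompactConeMap P T) {x y : X} {r s : ℝ}
    (hx : x ∈ interior P) (hy : y ∈ interior P) (hr : 0 < r) (hs : 0 < s)
    (hTx : T x = r • x) (hTy : T y = s • y) : ∃ c : ℝ, 0 < c ∧ x = c • y := by
  have key : ∀ {x y : X} {r s : ℝ}, x ∈ interior P → y ∈ interior P → 0 < r → 0 < s →
      T x = r • x → T y = s • y → (∃ c : ℝ, 0 < c ∧ x = c • y) ∨ s < r := by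
    intro x y r s hx hy hr hs hTx hTy
    obtain ⟨c, hc, hmax⟩ := hP.exists_isGreatest_smul hy x
    have hc0 : 0 < c := by
      obtain ⟨κ, hκ, h⟩ := hP.exists_sub_smul_mem hx (interior_subset hy)
      exact hκ.trans_le (hmax h)
    by_cases hxy : x = c • y
    · exact .inl ⟨c, hc0, hxy⟩
    right
    -- Applying `T` to `c y ⪯ x` leaves room `κ y`: `r x ⪰ (c s + κ) y`. Maximality of `c` then
    -- gives `s < r`.
    have h1 := hT.superadditive.strict_mono hP hT.stronglyPositive hc hxy
    rw [hT.posHomogeneous.map_smul hc0.le, hTx, hTy] at h1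
    obtain ⟨κ, hκ, h⟩ := hP.exists_sub_smul_mem h1 (interior_subset hy)
    have h2 := hP.smul_mem r⁻¹ (by positivity) _ h
    have h3 : r⁻¹ * (c * s + κ) ≤ c := hmax (by
      change x - _ ∈ P
      convert h2 using 1
      have h5 : x = r⁻¹ • (r • x) := by rw [smul_smul, inv_mul_cancel₀ hr.ne', one_smul]
      nth_rewrite 1 [h5]
      module)
    rw [inv_mul_le_iff₀ hr] at h3
    by_contra! h5
    nlinarith
  rcases key hx hy hr hs hTx hTy with h | h
  · exact h
  rcases key hy hx hs hr hTy hTx with ⟨c, hc, h'⟩ | h'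
  · exact ⟨c⁻¹, by positivity, by rw [h', smul_smul, inv_mul_cancel₀ hc.ne', one_smul]⟩
  · exact absurd h h'.not_gt

end IsCompactConeMap

end ConeMaps

/-- Cauchy's functional equation, reduced to the real line by odd extension. -/
lemma NNReal.eq_mul_of_continuous_of_map_add {f : ℝ≥0 → ℝ} (hc : Continuous f)
    (hadd : ∀ s t, f (s + t) = f s + f t) (t : ℝ≥0) : f t = f 1 * t := by
  have hf0 : f 0 = 0 := by simpa using hadd 0 0
  let g : ℝ →+ ℝ := AddMonoidHom.mk' (fun x => f x.toNNReal - f (-x).toNNReal) (fun x y => by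
    have h : (x + y).toNNReal + (-x).toNNReal + (-y).toNNReal
        = (-(x + y)).toNNReal + x.toNNReal + y.toNNReal := by
      apply NNReal.eq
      have h1 := max_zero_sub_max_neg_zero_eq_self x
      have h2 := max_zero_sub_max_neg_zero_eq_self y
      have h3 := max_zero_sub_max_neg_zero_eq_self (x + y)
      simp only [NNReal.coe_add, Real.coe_toNNReal']
      linarith
    have h' := congrArg f h
    simp only [hadd] at h'
    linarith)
  have hg : Continuous g :=
    (hc.comp continuous_real_toNNReal).sub (hc.comp (continuous_real_toNNReal.comp continuous_neg))
  have h1 := map_real_smul g hg t 1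
  have h2 : ∀ s : ℝ≥0, g s = f s := fun s => by
    have h : (-(s : ℝ)).toNNReal = 0 := Real.toNNReal_of_nonpos (by simp)
    simp [g, hf0, h]
  have h3 : g 1 = f 1 := by simpa using h2 1
  rw [smul_eq_mul, mul_one, smul_eq_mul, h2, h3] at h1
  rw [h1, mul_comm]

/-! ### The semigroup: eigenpair, bounds, convergence and rate. -/

section Semigroup

variable {X : Type*} [NormedAddCommGroup X] [NormedSpace ℝ X] {P : Set X} {S : ℝ≥0 → X → X}

lemma IsPosHomogeneous.norm_le_mul_norm (hP : IsOrderCone P) {T : X → X}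
    (hT : IsPosHomogeneous T) {C : ℝ} (h : ∀ x ∈ P, ‖x‖ ≤ 1 → ‖T x‖ ≤ C) {x : X} (hx : x ∈ P) :
    ‖T x‖ ≤ C * ‖x‖ := by
  have h1 : T (‖x‖ • (‖x‖⁻¹ • x)) = ‖x‖ • T (‖x‖⁻¹ • x) := hT.map_smul (norm_nonneg x) _
  rcases eq_or_ne x 0 with rfl | hx0
  · simp [hT.map_zero]
  have hn : ‖x‖ ≠ 0 := norm_ne_zero_iff.2 hx0
  rw [smul_smul, mul_inv_cancel₀ hn, one_smul] at h1
  rw [h1, norm_smul, norm_norm, mul_comm]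
  exact mul_le_mul_of_nonneg_right
    (h _ (hP.smul_mem _ (by positivity) _ hx) (by simp [norm_smul, hn])) (norm_nonneg x)

namespace IsSuperadditiveSemigroup

lemma isCompactConeMap (hS : IsSuperadditiveSemigroup P S) {t : ℝ≥0} (ht : 0 < t) :
    IsCompactConeMap P (S t) :=
  ⟨hS.superadditive t, hS.posHomogeneous t, hS.stronglyPositive t ht, hS.completelyContinuous t ht⟩

lemma mapsTo (hP : IsOrderCone P) (hS : IsSuperadditiveSemigroup P S) (t : ℝ≥0) {x : X}
    (hx : x ∈ P) : S t x ∈ P := by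
  rcases eq_zero_or_pos t with rfl | ht
  · rwa [hS.zero_apply]
  · exact (hS.isCompactConeMap ht).mapsTo hP hx

lemma mono (hP : IsOrderCone P) (hS : IsSuperadditiveSemigroup P S) (t : ℝ≥0) {x y : X}
    (h : y - x ∈ P) : S t y - S t x ∈ P :=
  (hS.superadditive t).mono hP (fun _ => hS.mapsTo hP t) h

lemma exists_norm_le (hS : IsSuperadditiveSemigroup P S) (t : ℝ≥0) :
    ∃ C : ℝ, 0 < C ∧ ∀ x, ‖S t x‖ ≤ C * ‖x‖ := by
  rcases eq_zero_or_pos t with rfl | ht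
  · exact ⟨1, one_pos, fun x => by rw [hS.zero_apply, one_mul]⟩
  · exact (hS.completelyContinuous t ht).exists_norm_le (hS.posHomogeneous t)

lemma exists_isPrincipalEigenpair (hP : IsOrderCone P) (hPint : (interior P).Nonempty)
    (hS : IsSuperadditiveSemigroup P S) : ∃ ρ xhat, IsPrincipalEigenpair P S ρ xhat := by
  obtain ⟨r, hr, x, hx, hx1, hTx⟩ :=
    (hS.isCompactConeMap one_pos).exists_eigenvector hP hPint
  have hxP := interior_subset hx
  have hx0 := hP.ne_zero_of_mem_interior hx
  have hφ : ∀ t, ∃ c : ℝ, 0 < c ∧ S t x = c • x := fun t => by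
    have hint : S t x ∈ interior P := by
      rcases eq_zero_or_pos t with rfl | ht
      · rwa [hS.zero_apply]
      · exact hS.stronglyPositive t ht x hxP hx0
    -- `S t` commutes with `S 1`, so `S t x` is again an interior eigenvector of `S 1`.
    refine (hS.isCompactConeMap one_pos).eigenvector_unique hP hint hx hr hr ?_ hTx
    rw [← hS.add_apply, add_comm, hS.add_apply, hTx, (hS.posHomogeneous t).map_smul hr.le]
  choose φ hφ0 hφ using hφ
  have hφn : ∀ t, φ t = ‖S t x‖ := fun t => by
    rw [hφ, norm_smul, hx1, mul_one, Real.norm_of_nonneg (hφ0 t).le]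
  have hφc : Continuous φ := by
    simp_rw [funext hφn]
    exact (hS.continuous_orbit x).norm
  have hφadd : ∀ s t, φ (s + t) = φ s * φ t := fun s t => by
    have h1 : φ (s + t) • x = (φ t * φ s) • x := by
      rw [← hφ, hS.add_apply, hφ t, (hS.posHomogeneous s).map_smul (hφ0 t).le, hφ s, smul_smul]
    rw [smul_left_injective ℝ hx0 h1, mul_comm]
  refine ⟨Real.log (φ 1), x, hx, hx1, fun t => ?_⟩
  have h1 := NNReal.eq_mul_of_continuous_of_map_add (f := fun t => Real.log (φ t))
    (hφc.log fun t => (hφ0 t).ne')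
    (fun s t => by rw [hφadd, Real.log_mul (hφ0 s).ne' (hφ0 t).ne']) t
  rw [← h1, Real.exp_log (hφ0 t), hφ]

lemma isPrincipalEigenpair_unique (hP : IsOrderCone P) (hS : IsSuperadditiveSemigroup P S)
    {ρ σ : ℝ} {x y : X} (hx : IsPrincipalEigenpair P S ρ x) (hy : IsPrincipalEigenpair P S σ y) :
    ρ = σ ∧ x = y := by
  have h1 := hx.2.2 1
  have h2 := hy.2.2 1
  simp only [NNReal.coe_one, mul_one] at h1 h2
  obtain ⟨c, hc, hxy⟩ := (hS.isCompactConeMap one_pos).eigenvector_unique hP hx.1 hy.1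
    (Real.exp_pos _) (Real.exp_pos _) h1 h2
  have hc1 : c = 1 := by
    have h3 := hx.2.1
    rwa [hxy, norm_smul, hy.2.1, mul_one, Real.norm_of_nonneg hc.le] at h3
  rw [hc1, one_smul] at hxy
  subst hxy
  rw [h1] at h2
  exact ⟨Real.exp_injective (smul_left_injective ℝ (hP.ne_zero_of_mem_interior hx.1) h2), rfl⟩

/-- The rescaled semigroup `e^{-ρ t} S t`. -/
lemma rescale (hP : IsOrderCone P) (hS : IsSuperadditiveSemigroup P S) (ρ : ℝ) :
    IsSuperadditiveSemigroup P fun t x => Real.exp (-(ρ * t)) • S t x where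
  zero_apply x := by simp [hS.zero_apply]
  add_apply s t x := by
    rw [(hS.posHomogeneous s).map_smul (Real.exp_pos _).le, smul_smul, ← Real.exp_add,
      hS.add_apply, NNReal.coe_add]
    congr 2
    ring
  continuous_orbit x := by
    have := hS.continuous_orbit x
    fun_prop
  superadditive t x y := by
    have := hP.smul_mem _ (Real.exp_pos (-(ρ * t))).le _ (hS.superadditive t x y)
    rwa [smul_sub, smul_add] at this
  posHomogeneous t c hc x := by
    simp only [hS.posHomogeneous t c hc]
    rw [smul_comm]
  stronglyPositive t ht x hx h0 :=
    hP.smul_mem_interior (hS.stronglyPositive t ht x hx h0) (Real.exp_pos _)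
  completelyContinuous t ht := by
    obtain ⟨h1, h2⟩ := hS.completelyContinuous t ht
    refine ⟨h1.const_smul _, fun B hB => ?_⟩
    refine ((h2 B hB).image (continuous_const_smul (Real.exp (-(ρ * t))))).closure_of_subset ?_
    rintro _ ⟨x, hx, rfl⟩
    exact ⟨S t x, subset_closure ⟨x, hx, rfl⟩, rfl⟩

/-- Uniform boundedness on compact time intervals away from `0`, by Baire's theorem in time. -/
lemma exists_norm_le_of_mem_Icc (hS : IsSuperadditiveSemigroup P S) {a : ℝ≥0} (ha : 0 < a)
    (b : ℝ≥0) : ∃ C : ℝ, ∀ s ∈ Icc a b, ∀ x ∈ P, ‖S s x‖ ≤ C * ‖x‖ := by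
  let F : ℕ → Set ℝ≥0 := fun n => {s | ∀ x ∈ P, ‖S s x‖ ≤ n * ‖x‖}
  have hF : ∀ n, IsClosed (F n) := fun n => by
    simp only [F, ofPred_forall]
    exact isClosed_iInter fun x => isClosed_iInter fun _ =>
      isClosed_le (hS.continuous_orbit x).norm continuous_const
  have hU : ⋃ n, F n = univ := by
    refine eq_univ_of_forall fun s => mem_iUnion.2 ?_
    obtain ⟨C, -, hC⟩ := hS.exists_norm_le s
    obtain ⟨n, hn⟩ := exists_nat_ge C
    exact ⟨n, fun x _ => (hC x).trans (by gcongr)⟩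
  obtain ⟨s₀, hs₀, hmem⟩ := (dense_iUnion_interior_of_closed hF hU).exists_mem_open
    (isOpen_Ioo (a := (0 : ℝ≥0)) (b := a)) (nonempty_Ioo.2 ha)
  obtain ⟨n, hn⟩ := mem_iUnion.1 hs₀
  refine isCompact_Icc.induction_on (p := fun A => ∃ C : ℝ, ∀ s ∈ A, ∀ x ∈ P, ‖S s x‖ ≤ C * ‖x‖)
    ⟨0, by simp⟩ (fun A B hAB ⟨C, hC⟩ => ⟨C, fun s hs => hC s (hAB hs)⟩) ?_ ?_
  · rintro A B ⟨C, hC⟩ ⟨D, hD⟩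
    refine ⟨max C D, fun s hs x hx => ?_⟩
    rcases hs with hs | hs
    · exact (hC s hs x hx).trans (by gcongr; exact le_max_left _ _)
    · exact (hD s hs x hx).trans (by gcongr; exact le_max_right _ _)
  · intro t ht
    have hst : s₀ ≤ t := hmem.2.le.trans ht.1
    -- The bound near `s₀` is carried to a neighbourhood of `t` by the single operator `S (t - s₀)`.
    obtain ⟨C, hC0, hC⟩ := hS.exists_norm_le (t - s₀)
    refine ⟨{u | t - s₀ < u} ∩ (fun u => u - (t - s₀)) ⁻¹' interior (F n),
      mem_nhdsWithin_of_mem_nhds (IsOpen.mem_nhds ?_ ⟨?_, ?_⟩), C * n, fun u hu x hx => ?_⟩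
    · exact (isOpen_lt continuous_const continuous_id).inter
        (isOpen_interior.preimage (by fun_prop))
    · exact tsub_lt_self (hmem.1.trans_le hst) hmem.1
    · rw [mem_preimage, tsub_tsub_cancel_of_le hst]
      exact hn
    · have h1 : u = (t - s₀) + (u - (t - s₀)) := (add_tsub_cancel_of_le (le_of_lt hu.1)).symm
      rw [h1, hS.add_apply, mul_assoc]
      exact (hC _).trans (by gcongr; exact interior_subset hu.2 x hx)

/-- A semigroup with an interior fixed point is bounded on the cone for `t ≥ 1/2`. -/
lemma exists_norm_le_of_fixed (hP : IsOrderCone P) (hS : IsSuperadditiveSemigroup P S) {xhat : X}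
    (hx : xhat ∈ interior P) (hfix : ∀ t, S t xhat = xhat) :
    ∃ C : ℝ, ∀ s : ℝ≥0, 1 / 2 ≤ s → ∀ x ∈ P, ‖S s x‖ ≤ C * ‖x‖ := by
  obtain ⟨D, hD⟩ := hS.exists_norm_le_of_mem_Icc (a := 1 / 2) (by norm_num) (3 / 2)
  obtain ⟨m, hm0, hm⟩ := hP.exists_smul_sub_mem hx
  -- The orbit stays in `[0, m xhat]`, so each unit of time at most halves the norm and adds `C`;
  -- this keeps the bound `2 C + |D|`.
  obtain ⟨C, hC0, hC⟩ := (hS.isCompactConeMap one_pos).exists_norm_le_add_mul_norm hP xhat hm0.le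
    (ε := 1 / 2) (by norm_num)
  refine ⟨2 * C + |D|, fun s hs x hxP => ?_⟩
  refine (hS.posHomogeneous s).norm_le_mul_norm hP (fun x hxP hx1 => ?_) hxP
  have hle : ∀ t, m • xhat - S t x ∈ P := fun t => by
    have h1 := hS.mono hP t (hm x m (by nlinarith))
    rwa [(hS.posHomogeneous t).map_smul hm0.le, hfix] at h1
  obtain ⟨n, s', hs', rfl⟩ : ∃ n : ℕ, ∃ s' ∈ Icc (1 / 2 : ℝ≥0) (3 / 2), s = n + s' := by
    have h1 : ((⌊s - 1 / 2⌋₊ : ℕ) : ℝ≥0) ≤ s - 1 / 2 := Nat.floor_le zero_le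
    have h2 : s - 1 / 2 < (⌊s - 1 / 2⌋₊ : ℕ) + 1 := Nat.lt_floor_add_one _
    have h3 : ((⌊s - 1 / 2⌋₊ : ℕ) : ℝ≥0) + 1 / 2 ≤ s := (le_tsub_iff_right hs).1 h1
    have h4 : s ≤ 3 / 2 + (⌊s - 1 / 2⌋₊ : ℕ) := by
      rw [tsub_lt_iff_right hs] at h2
      refine h2.le.trans (le_of_eq ?_)
      rw [add_assoc, add_comm]
      norm_num
    refine ⟨⌊s - 1 / 2⌋₊, s - (⌊s - 1 / 2⌋₊ : ℕ), ⟨?_, ?_⟩, ?_⟩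
    · exact le_tsub_of_add_le_left h3
    · exact tsub_le_iff_right.2 h4
    · exact (add_tsub_cancel_of_le (le_self_add.trans h3)).symm
  clear hs
  induction n with
  | zero =>
    have h1 := hD s' hs' x hxP
    have h2 : D * ‖x‖ ≤ |D| * 1 := mul_le_mul (le_abs_self D) hx1 (norm_nonneg x) (abs_nonneg D)
    rw [Nat.cast_zero, zero_add]
    linarith
  | succ n ih =>
    have h1 := hC (S (n + s') x) (hS.mapsTo hP _ hxP) (hle _)
    rw [← hS.add_apply, ← add_assoc, add_comm 1 (n : ℝ≥0)] at h1
    rw [Nat.cast_succ]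
    linarith [abs_nonneg D]

/-- The orbit is bounded from time `1/2` on, and the last half unit of time makes it precompact. -/
lemma exists_isCompact_of_fixed (hP : IsOrderCone P) (hS : IsSuperadditiveSemigroup P S) {xhat : X}
    (hx : xhat ∈ interior P) (hfix : ∀ t, S t xhat = xhat) (r : ℝ) :
    ∃ K : Set X, IsCompact K ∧ ∀ t : ℝ≥0, 1 ≤ t → ∀ x ∈ P, ‖x‖ ≤ r → S t x ∈ K := by
  obtain ⟨C, hC⟩ := hS.exists_norm_le_of_fixed hP hx hfix
  refine ⟨_, (hS.completelyContinuous (1 / 2) (by norm_num)).2 (Metric.closedBall 0 (|C| * r))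
    Metric.isBounded_closedBall, fun t ht x hxP hxr => subset_closure ?_⟩
  have h1 : (1 / 2 : ℝ≥0) + 1 / 2 ≤ t := by rwa [add_halves]
  refine ⟨S (t - 1 / 2) x, ?_, ?_⟩
  · rw [mem_closedBall_zero_iff]
    refine (hC _ (le_tsub_of_add_le_left h1) x hxP).trans ?_
    exact mul_le_mul (le_abs_self C) hxr (norm_nonneg x) (abs_nonneg C)
  · rw [← hS.add_apply, add_tsub_cancel_of_le (le_self_add.trans h1)]

lemma exists_tendsto_of_fixed (hP : IsOrderCone P) (hS : IsSuperadditiveSemigroup P S) {xhat : X}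
    (hx : xhat ∈ interior P) (hfix : ∀ t, S t xhat = xhat) {x : X} (hxP : x ∈ P) :
    ∃ α : ℝ, 0 ≤ α ∧ Tendsto (fun t => S t x) atTop (𝓝 (α • xhat)) := by
  have hhP := interior_subset hx
  have hh0 := hP.ne_zero_of_mem_interior hx
  choose a ha hmax using fun t => hP.exists_isGreatest_smul hx (S t x)
  have ha0 : ∀ t, 0 ≤ a t := fun t => hmax t (by simpa using hS.mapsTo hP t hxP)
  have hmono : Monotone a := by
    intro s t hst
    refine hmax t ?_
    have h1 := hS.mono hP (t - s) (ha s)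
    rwa [(hS.posHomogeneous _).map_smul (ha0 s), hfix, ← hS.add_apply, tsub_add_cancel_of_le hst]
      at h1
  obtain ⟨m, hm0, hm⟩ := hP.exists_smul_sub_mem hx
  have hbdd : BddAbove (range a) := by
    refine ⟨m * ‖x‖, ?_⟩
    rintro _ ⟨t, rfl⟩
    have h1 := hS.mono hP t (hm x _ le_rfl)
    rw [(hS.posHomogeneous t).map_smul (by positivity), hfix] at h1
    exact hP.le_of_smul_sub_smul_mem hhP hh0 (ha t) h1
  have hlim := tendsto_atTop_ciSup hmono hbdd
  have hle : ∀ t, a t ≤ ⨆ t, a t := le_ciSup hbdd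
  set α := ⨆ t, a t
  have hα0 : 0 ≤ α := (ha0 0).trans (hle 0)
  obtain ⟨K, hK, hKmem⟩ := hS.exists_isCompact_of_fixed hP hx hfix ‖x‖
  refine ⟨α, hα0, hK.tendsto_nhds_of_unique_mapClusterPt
    ((eventually_ge_atTop 1).mono fun t ht => hKmem t ht x hxP le_rfl) fun y _ hy => ?_⟩
  obtain ⟨U, hU, hUy⟩ := mapClusterPt_iff_ultrafilter.1 hy
  have h1 : y - α • xhat ∈ P := hP.isClosed.mem_of_tendsto
    (hUy.sub ((hlim.mono_left hU).smul_const xhat)) (Eventually.of_forall ha)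
  by_contra hne
  have hT := hS.isCompactConeMap one_pos
  have h2 := hT.superadditive.strict_mono hP hT.stronglyPositive h1 hne
  -- A cluster point strictly above `α xhat` would put `S 1 y` above `(α + κ) xhat`; by continuity
  -- `a (1 + t)` would exceed its supremum `α` for some `t`.
  rw [hT.posHomogeneous.map_smul hα0, hfix] at h2
  obtain ⟨κ, hκ, h3⟩ := hP.exists_sub_smul_mem h2 hhP
  have h4 : S 1 y - (α + κ / 2) • xhat ∈ interior P := by
    have h5 := hP.add_mem_interior (hP.smul_mem_interior hx (half_pos hκ)) h3
    convert h5 using 1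
    module
  have h5 : Tendsto (fun t => S 1 (S t x) - (α + κ / 2) • xhat) U
      (𝓝 (S 1 y - (α + κ / 2) • xhat)) :=
    ((hT.completelyContinuous.1.tendsto y).comp hUy).sub_const _
  obtain ⟨t, ht⟩ := (h5.eventually (isOpen_interior.mem_nhds h4)).exists
  rw [← hS.add_apply] at ht
  have h6 : α + κ / 2 ≤ a (1 + t) := hmax _ (show S (1 + t) x - _ ∈ P from interior_subset ht)
  linarith [hle (1 + t)]

/-- Minorization: from time `t₀` on, one of `z` and `x̂ - z` has gained a fixed part of `x̂`. -/
lemma exists_minorization (hP : IsOrderCone P) (hS : IsSuperadditiveSemigroup P S) {xhat : X}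
    (hx : xhat ∈ interior P) {ζ : ℝ} (hζ0 : 0 < ζ)
    (hζ : ∀ x ∈ P, ∀ α : ℝ, α • xhat - x ∈ P → ‖x‖ ≤ α * ζ) (h1 : PropertyP1 P S xhat) :
    ∃ t₀ : ℝ≥0, 0 < t₀ ∧ ∃ κ : ℝ, 0 < κ ∧ κ < 1 ∧ ∀ z ∈ P, xhat - z ∈ P →
      S t₀ z - κ • xhat ∈ P ∨ S t₀ (xhat - z) - κ • xhat ∈ P := by
  obtain ⟨τ, hτ0, -, ζ₀, hζ₀, hτ⟩ := h1 ζ hζ0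
  have hcc := hS.completelyContinuous τ hτ0
  -- By (P1) one of `S τ z` and `S τ (xhat - z)` has norm at least `ζ₀ / 2`. Such vectors form a
  -- compact set avoiding `0`, which `S 1` sends uniformly inside the cone.
  let K : Set X := closure (S τ '' Metric.closedBall 0 ζ) ∩ (P ∩ {y | ζ₀ / 2 ≤ ‖y‖})
  have hK : IsCompact K := (hcc.2 _ Metric.isBounded_closedBall).inter_right
    (hP.isClosed.inter (isClosed_le continuous_const continuous_norm))
  have hK' : IsCompact (S 1 '' K) := hK.image (hS.completelyContinuous 1 one_pos).1
  obtain ⟨κ, hκ0, hκ1, hκ⟩ := hP.exists_forall_sub_smul_mem hK' (by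
    rintro _ ⟨y, ⟨-, hyP, hy⟩, rfl⟩
    refine hS.stronglyPositive 1 one_pos y hyP ?_
    rintro rfl
    simp only [mem_ofPred_eq, norm_zero] at hy
    linarith) (interior_subset hx)
  have key : ∀ z ∈ P, xhat - z ∈ P → ζ₀ / 2 ≤ ‖S τ z‖ → S (1 + τ) z - κ • xhat ∈ P := by
    intro z hz hzx h
    rw [hS.add_apply]
    refine hκ _ ⟨S τ z, ⟨subset_closure ⟨z, ?_, rfl⟩, hS.mapsTo hP τ hz, h⟩, rfl⟩ κ le_rfl
    rw [mem_closedBall_zero_iff]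
    simpa using hζ z hz 1 (by simpa using hzx)
  refine ⟨1 + τ, by positivity, κ, hκ0, hκ1, fun z hz hzx => ?_⟩
  have h2 := hτ z hz hzx (by simpa using hζ z hz 1 (by simpa using hzx))
  rcases le_total (ζ₀ / 2) ‖S τ z‖ with h | h
  · exact .inl (key z hz hzx h)
  · exact .inr (key _ hzx (by simpa using hz) (by linarith))

/-- Minorization contracts the width of order intervals `[a x̂, b x̂]`. -/
lemma exists_order_interval_contraction (hP : IsOrderCone P) (hS : IsSuperadditiveSemigroup P S)
    {xhat : X} (hfix : ∀ t, S t xhat = xhat) {t₀ : ℝ≥0} {κ : ℝ} (hκ0 : 0 < κ) (hκ1 : κ < 1)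
    (hmin : ∀ z ∈ P, xhat - z ∈ P → S t₀ z - κ • xhat ∈ P ∨ S t₀ (xhat - z) - κ • xhat ∈ P)
    {x : X} {a b : ℝ} (ha : 0 ≤ a) (hab : a ≤ b) (hax : x - a • xhat ∈ P)
    (hxb : b • xhat - x ∈ P) :
    ∃ a' b' : ℝ, 0 ≤ a' ∧ a' ≤ b' ∧ S t₀ x - a' • xhat ∈ P ∧ b' • xhat - S t₀ x ∈ P ∧
      b' - a' = (1 - κ) * (b - a) := by
  have hlow := hS.mono hP t₀ hax
  have hup := hS.mono hP t₀ hxb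
  rw [(hS.posHomogeneous _).map_smul ha, hfix] at hlow
  rw [(hS.posHomogeneous _).map_smul (ha.trans hab), hfix] at hup
  rcases hab.eq_or_lt with rfl | hlt
  · exact ⟨a, a, ha, le_rfl, hlow, hup, by ring⟩
  have hd : 0 < b - a := sub_pos.2 hlt
  have hz : xhat - (b - a)⁻¹ • (x - a • xhat) = (b - a)⁻¹ • (b • xhat - x) := by
    have h5 : xhat = (b - a)⁻¹ • ((b - a) • xhat) := by
      rw [smul_smul, inv_mul_cancel₀ hd.ne', one_smul]
    nth_rewrite 1 [h5]
    module
  have h1 := hmin ((b - a)⁻¹ • (x - a • xhat)) (hP.smul_mem _ (by positivity) _ hax)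
    (by rw [hz]; exact hP.smul_mem _ (by positivity) _ hxb)
  rw [hz, (hS.posHomogeneous _).map_smul (by positivity),
    (hS.posHomogeneous _).map_smul (by positivity)] at h1
  have hscale : ∀ w : X, (b - a)⁻¹ • w - κ • xhat ∈ P → w - ((b - a) * κ) • xhat ∈ P := by
    intro w hw
    have h2 := hP.smul_mem _ hd.le _ hw
    rwa [smul_sub, smul_smul, smul_smul, mul_inv_cancel₀ hd.ne', one_smul] at h2
  have hdκ : (b - a) * κ ≤ b - a := by nlinarith
  have hdκ0 : 0 ≤ (b - a) * κ := by positivity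
  -- Superadditivity serves both ends: split as `x = a xhat + (x - a xhat)` it raises the lower
  -- bound, and split as `b xhat = x + (b xhat - x)` it lowers the upper one.
  rcases h1 with h1 | h1
  · refine ⟨a + (b - a) * κ, b, by linarith, by linarith, ?_, hup, by ring⟩
    have h2 := hS.superadditive t₀ (a • xhat) (x - a • xhat)
    rw [ConeLE, add_sub_cancel, (hS.posHomogeneous _).map_smul ha, hfix] at h2
    convert hP.add_mem _ h2 _ (hscale _ h1) using 1
    module
  · refine ⟨a, b - (b - a) * κ, ha, by linarith, hlow, ?_, by ring⟩
    have h2 := hS.superadditive t₀ x (b • xhat - x)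
    rw [ConeLE, add_sub_cancel, (hS.posHomogeneous _).map_smul (ha.trans hab), hfix] at h2
    convert hP.add_mem _ h2 _ (hscale _ h1) using 1
    module

lemma exists_norm_sub_le_of_fixed (hP : IsOrderCone P) (hS : IsSuperadditiveSemigroup P S)
    {xhat : X} (hx : xhat ∈ interior P) (hx1 : ‖xhat‖ = 1) (hfix : ∀ t, S t xhat = xhat)
    {α : X → ℝ} (hα : ∀ x ∈ P, Tendsto (fun t => S t x) atTop (𝓝 (α x • xhat)))
    (h1 : PropertyP1 P S xhat) (h2 : PropertyP2 P xhat) :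
    ∃ M₀ θ₀ : ℝ, 0 < M₀ ∧ 0 < θ₀ ∧ ∀ t : ℝ≥0, ∀ x ∈ P,
      ‖S t x - α x • xhat‖ ≤ M₀ * Real.exp (-(θ₀ * t)) * ‖x‖ := by
  have hhP := interior_subset hx
  have hh0 := hP.ne_zero_of_mem_interior hx
  obtain ⟨ζ, hζ0, hζ⟩ := hP.exists_norm_le_of_propertyP2 hx h2
  obtain ⟨t₀, ht₀, κ, hκ0, hκ1, hmin⟩ := hS.exists_minorization hP hx hζ0 hζ h1
  obtain ⟨m, hm0, hm⟩ := hP.exists_smul_sub_mem hx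
  have hiter : ∀ x ∈ P, ∀ n : ℕ, ∃ a b : ℝ, 0 ≤ a ∧ a ≤ b ∧ S (n * t₀) x - a • xhat ∈ P ∧
      b • xhat - S (n * t₀) x ∈ P ∧ b - a = (1 - κ) ^ n * (m * ‖x‖) := by
    intro x hxP n
    induction n with
    | zero =>
      refine ⟨0, m * ‖x‖, le_rfl, by positivity, ?_, ?_, by ring⟩
      · simpa [hS.zero_apply] using hxP
      · simpa [hS.zero_apply] using hm x _ le_rfl
    | succ n ih =>
      obtain ⟨a, b, ha, hab, hax, hxb, hd⟩ := ih
      obtain ⟨a', b', ha', hab', hax', hxb', hd'⟩ :=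
        hS.exists_order_interval_contraction hP hfix hκ0 hκ1 hmin ha hab hax hxb
      rw [← hS.add_apply, show t₀ + n * t₀ = ((n + 1 : ℕ) : ℝ≥0) * t₀ by push_cast; ring]
        at hax' hxb'
      exact ⟨a', b', ha', hab', hax', hxb', by rw [hd', hd]; ring⟩
  have hq : 0 < 1 - κ := by linarith
  have hlog : Real.log (1 - κ) < 0 := Real.log_neg hq (by linarith)
  have ht₀' : (0 : ℝ) < t₀ := NNReal.coe_pos.2 ht₀
  -- The width is multiplied by `1 - κ` every `t₀`; the factor `(1 - κ)⁻¹` pays for rounding `t /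
  -- t₀` down. In `ζ + 1`, normality bounds `S t x - a xhat` and `‖xhat‖ = 1` bounds `(α x - a)
  -- xhat`.
  refine ⟨(ζ + 1) * m * (1 - κ)⁻¹, -Real.log (1 - κ) / t₀, by positivity,
    div_pos (by linarith) ht₀', fun t x hxP => ?_⟩
  set n : ℕ := ⌊t / t₀⌋₊
  have hn1 : n * t₀ ≤ t := by
    have h3 : (n : ℝ≥0) ≤ t / t₀ := Nat.floor_le zero_le
    rwa [le_div_iff₀ ht₀] at h3
  have hn2 : (t : ℝ) / t₀ ≤ n + 1 := by
    have h3 : t / t₀ < n + 1 := Nat.lt_floor_add_one _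
    exact_mod_cast h3.le
  obtain ⟨a, b, ha, hab, hax, hxb, hd⟩ := hiter x hxP n
  have hlow : ∀ s, n * t₀ ≤ s → S s x - a • xhat ∈ P := fun s hs => by
    have h3 := hS.mono hP (s - n * t₀) hax
    rwa [(hS.posHomogeneous _).map_smul ha, hfix, ← hS.add_apply, tsub_add_cancel_of_le hs] at h3
  have hup : ∀ s, n * t₀ ≤ s → b • xhat - S s x ∈ P := fun s hs => by
    have h3 := hS.mono hP (s - n * t₀) hxb
    rwa [(hS.posHomogeneous _).map_smul (ha.trans hab), hfix, ← hS.add_apply,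
      tsub_add_cancel_of_le hs] at h3
  have hαa : α x • xhat - a • xhat ∈ P := hP.isClosed.mem_of_tendsto ((hα x hxP).sub_const _)
    ((eventually_ge_atTop (n * t₀)).mono hlow)
  have hαb : b • xhat - α x • xhat ∈ P := hP.isClosed.mem_of_tendsto ((hα x hxP).const_sub _)
    ((eventually_ge_atTop (n * t₀)).mono hup)
  rw [← sub_smul] at hαa hαb
  have hαa' := hP.nonneg_of_smul_mem hhP hh0 hαa
  have hαb' := hP.nonneg_of_smul_mem hhP hh0 hαb
  have h3 : ‖S t x - a • xhat‖ ≤ (b - a) * ζ := by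
    refine hζ _ (hlow t hn1) _ ?_
    convert hup t hn1 using 1
    module
  have h4 : ‖(α x - a) • xhat‖ ≤ b - a := by
    rw [norm_smul, hx1, mul_one, Real.norm_of_nonneg hαa']
    linarith
  have h5 : ‖S t x - α x • xhat‖ ≤ (ζ + 1) * (b - a) := by
    have h6 : S t x - α x • xhat = (S t x - a • xhat) - (α x - a) • xhat := by module
    rw [h6]
    refine (norm_sub_le _ _).trans ?_
    linarith
  have h6 : (1 - κ) ^ n ≤ (1 - κ)⁻¹ * Real.exp (-(-Real.log (1 - κ) / t₀ * t)) := by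
    rw [← Real.exp_log hq, ← Real.exp_nat_mul, ← Real.exp_neg, ← Real.exp_add, Real.exp_le_exp,
      Real.log_exp]
    have h7 : -(-Real.log (1 - κ) / t₀ * t) = Real.log (1 - κ) * (t / t₀) := by ring
    rw [h7]
    nlinarith
  calc ‖S t x - α x • xhat‖ ≤ (ζ + 1) * ((1 - κ) ^ n * (m * ‖x‖)) := by rw [← hd]; exact h5
    _ ≤ (ζ + 1) * ((1 - κ)⁻¹ * Real.exp (-(-Real.log (1 - κ) / t₀ * t)) * (m * ‖x‖)) := by
      gcongr
    _ = _ := by ring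

end IsSuperadditiveSemigroup

lemma PropertyP1.rescale {xhat : X} (h : PropertyP1 P S xhat) (ρ : ℝ) :
    PropertyP1 P (fun t x => Real.exp (-(ρ * t)) • S t x) xhat := by
  intro M hM
  obtain ⟨τ, h0, h1, ζ₀, hζ, H⟩ := h M hM
  refine ⟨τ, h0, h1, Real.exp (-(ρ * τ)) * ζ₀, by positivity, fun z hz hzx hzM => ?_⟩
  simp only [norm_smul, Real.norm_of_nonneg (Real.exp_pos _).le]
  rw [← mul_add]
  exact mul_le_mul_of_nonneg_left (H z hz hzx hzM) (Real.exp_pos _).le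

end Semigroup

/-! ### Assembly, by passing to the rescaled semigroup. -/

theorem mainTheorem3 {X : Type*} [NormedAddCommGroup X] [NormedSpace ℝ X] [CompleteSpace X]
    (P : Set X) (hP : IsOrderCone P) (hPint : (interior P).Nonempty)
    (S : ℝ≥0 → X → X) (hS : IsSuperadditiveSemigroup P S) :
    (∃! p : ℝ × X, IsPrincipalEigenpair P S p.1 p.2) ∧
    ∀ (ρ : ℝ) (xhat : X), IsPrincipalEigenpair P S ρ xhat →
      IsCompact (closure (normalizedOrbit P S ρ)) ∧
      ∃ αstar : X → ℝ,
        (∀ x ∈ P, 0 ≤ αstar x ∧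
          Tendsto (fun t : ℝ≥0 => ‖Real.exp (-(ρ * t)) • S t x - αstar x • xhat‖)
            atTop (𝓝 0)) ∧
        (PropertyP1 P S xhat → PropertyP2 P xhat →
          ∃ M₀ θ₀ : ℝ, 0 < M₀ ∧ 0 < θ₀ ∧ ∀ t : ℝ≥0, ∀ x ∈ P,
            ‖Real.exp (-(ρ * t)) • S t x - αstar x • xhat‖
              ≤ M₀ * Real.exp (-(θ₀ * t)) * ‖x‖) := by
  refine ⟨?_, fun ρ xhat ⟨hx, hx1, heig⟩ => ?_⟩
  · obtain ⟨ρ, x, h⟩ := hS.exists_isPrincipalEigenpair hP hPint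
    refine ⟨(ρ, x), h, fun q hq => ?_⟩
    obtain ⟨h1, h2⟩ := hS.isPrincipalEigenpair_unique hP hq h
    exact Prod.ext h1 h2
  have hR := hS.rescale hP ρ
  have hfix : ∀ t : ℝ≥0, Real.exp (-(ρ * t)) • S t xhat = xhat := fun t => by
    rw [heig, smul_smul, ← Real.exp_add, neg_add_cancel, Real.exp_zero, one_smul]
  refine ⟨?_, ?_⟩
  · obtain ⟨K, hK, hKmem⟩ := hR.exists_isCompact_of_fixed hP hx hfix 1
    refine hK.closure_of_subset ?_
    rintro _ ⟨x, hxP, hx1, t, ht, rfl⟩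
    exact hKmem t ht x hxP hx1
  have hlim := fun x (hxP : x ∈ P) => hR.exists_tendsto_of_fixed hP hx hfix hxP
  choose! α hα0 hα using hlim
  refine ⟨α, fun x hxP => ⟨hα0 x hxP, tendsto_iff_norm_sub_tendsto_zero.1 (hα x hxP)⟩,
    fun h1 h2 => ?_⟩
  exact hR.exists_norm_sub_le_of_fixed hP hx hx1 hfix hα (h1.rescale ρ) h2
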